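/- All graphs are finite, simple and nonempty. A complete multipartite graph is a graph whose vertex set is partitioned into nonempty classes such that two vertices are adjacent if and only if they lie in different classes. For a graph $G$ with vertex set $V(G)$ and edge set $E(G)$ let $\mu(S)=|S|/|V(G)|$ for $S\subseteq V(G)$, let $\partial S=\{w\in V(G):\{v,w\}\in E(G)\text{ for some }v\in S\}$, let $\beta(G)=\alpha(G)/|V(G)|$, where $\alpha(G)$ is the largest size of an independent set in $G$, and for $\nu\in[0,1]$ let $\Phi(G,\nu)=\min\{\mu(\partial S):S\subseteq V(G),\ \mu(S)\ge\nu\}$. The direct product $H_1\times\cdots\times H_n$ has vertex set $V(H_1)\times\cdots\times V(H_n)$, with $(g_1,\ldots,g_n)$ and $(g_1',\ldots,g_n')$ adjacent if and only if $\{g_i,g_i'\}\in E(H_i)$ for all $i$. **Theorem 1.5.** Let $n\ge 1$ and let $H_1,\ldots,H_n$ be complete multipartite graphs such that $\beta(H_1)\le\cdots\le\beta(H_n)$ and $$\prod_{k\in A}\frac{1-\beta(H_k)}{\beta(H_k)}\ \ge\ \frac{1-\beta(H_n)}{\beta(H_n)}\qquad\text{for all nonempty }A\subseteq\{1,\ldots,n-1\}.$$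 Then for every $\nu\in[0,1]$ $$\Phi(H_1,\nu)=\begin{cases}0,&\nu=0;\\ 1-\beta(H_1),&0<\nu\le\beta(H_1);\\ 1,&\beta(H_1)<\nu\le 1,\end{cases}$$ and, if $n\ge 2$, for every $\nu\in[0,1]$ $$\Phi(H_1\times\cdots\times H_n,\nu)=\begin{cases}0,&\nu=0;\\ (1-\beta(H_n))\,\Phi\!\left(H_1\times\cdots\times H_{n-1},\dfrac{\nu}{\beta(H_n)}\right),&0<\nu\le\beta(H_n);\\ 1-\beta(H_n)+\beta(H_n)\,\Phi\!\left(H_1\times\cdots\times H_{n-1},\dfrac{\nu-\beta(H_n)}{1-\beta(H_n)}\right),&\beta(H_n)<\nu\le 1.\end{cases}$$ -/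

import Mathlib

/-- The direct (tensor) product of a family of graphs: two vertices are adjacent iff all their
coordinates are adjacent. For a nonempty index type the clause `f ≠ g` follows from the other
one; it only serves to make the product of an empty family loopless. -/
def directProduct {ι : Type*} {V : ι → Type*} (H : ∀ i, SimpleGraph (V i)) :
    SimpleGraph (∀ i, V i) where
  Adj f g := f ≠ g ∧ ∀ i, (H i).Adj (f i) (g i)
  symm := ⟨fun _ _ h => ⟨h.1.symm, fun i => (h.2 i).symm⟩⟩
  loopless := ⟨fun _ h => h.1 rfl⟩

theorem directProduct_adj {ι : Type*} [Nonempty ι] {V : ι → Type*} (H : ∀ i, SimpleGraph (V i))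
    (f g : ∀ i, V i) : (directProduct H).Adj f g ↔ ∀ i, (H i).Adj (f i) (g i) := by
  refine ⟨fun h => h.2, fun h => ⟨?_, h⟩⟩
  rintro rfl
  exact (H (Classical.arbitrary ι)).irrefl (h _)

/-- The vertex boundary `∂S`: all vertices having a neighbour in `S` (possibly inside `S`). -/
def vertexBoundary {V : Type*} (G : SimpleGraph V) (S : Set V) : Set V :=
  {w | ∃ v ∈ S, G.Adj v w}

/-- The uniform probability measure on a finite nonempty vertex set, `μ(S) = |S| / |V|`. -/
noncomputable def uniformMeasure {V : Type*} (S : Set V) : ℝ :=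
  (S.ncard : ℝ) / (Nat.card V : ℝ)

/-- The vertex isoperimetric profile with respect to the uniform measure,
`Φ(G, ν) = min {μ(∂S) : S ⊆ V(G), μ(S) ≥ ν}`. The minimum is attained for `ν ≤ 1` on a finite
nonempty graph, see `isLeast_isoProfile`. -/
noncomputable def isoProfile {V : Type*} (G : SimpleGraph V) (ν : ℝ) : ℝ :=
  sInf {x : ℝ | ∃ S : Set V, ν ≤ uniformMeasure S ∧ x = uniformMeasure (vertexBoundary G S)}

theorem isLeast_isoProfile {V : Type*} [Finite V] [Nonempty V] (G : SimpleGraph V) {ν : ℝ}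
    (hν : ν ≤ 1) :
    IsLeast {x : ℝ | ∃ S : Set V, ν ≤ uniformMeasure S ∧
      x = uniformMeasure (vertexBoundary G S)} (isoProfile G ν) := by
  have hfin : {x : ℝ | ∃ S : Set V, ν ≤ uniformMeasure S ∧
      x = uniformMeasure (vertexBoundary G S)}.Finite :=
    (Set.finite_range fun S : Set V => uniformMeasure (vertexBoundary G S)).subset
      (by rintro x ⟨S, -, rfl⟩; exact ⟨S, rfl⟩)
  have hne : {x : ℝ | ∃ S : Set V, ν ≤ uniformMeasure S ∧
      x = uniformMeasure (vertexBoundary G S)}.Nonempty := by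
    refine ⟨_, Set.univ, ?_, rfl⟩
    have : (Nat.card V : ℝ) ≠ 0 := by exact_mod_cast Nat.card_pos.ne'
    simpa [uniformMeasure, Set.ncard_univ, this] using hν
  exact ⟨hne.csInf_mem hfin, fun x hx => csInf_le hfin.bddBelow hx⟩

/-- The independence ratio `β(G) = α(G) / |V(G)|`. -/
noncomputable def indepRatio {V : Type*} (G : SimpleGraph V) : ℝ :=
  (G.indepNum : ℝ) / (Nat.card V : ℝ)

/-- The profile is invariant under graph isomorphism. -/
theorem isoProfile_congr {V W : Type*} {G : SimpleGraph V} {K : SimpleGraph W} (e : G ≃g K)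
    (ν : ℝ) : isoProfile G ν = isoProfile K ν := by
  have hμ : ∀ S : Set V, uniformMeasure (e '' S) = uniformMeasure S := fun S => by
    rw [uniformMeasure, uniformMeasure, Set.ncard_image_of_injective _ e.injective,
      Nat.card_congr e.toEquiv]
  have hb : ∀ S : Set V, vertexBoundary K (e '' S) = e '' vertexBoundary G S := fun S => by
    ext w
    obtain ⟨w, rfl⟩ := e.surjective w
    simp [vertexBoundary, e.map_adj_iff]
  unfold isoProfile
  congr 1
  ext x
  constructor
  · rintro ⟨S, h, rfl⟩
    exact ⟨e '' S, by rwa [hμ], by rw [hb, hμ]⟩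
  · rintro ⟨T, h, rfl⟩
    have hT : e '' (e ⁻¹' T) = T := Set.image_preimage_eq T e.surjective
    rw [← hT, hμ] at h
    exact ⟨e ⁻¹' T, h, by rw [← hμ, ← hb, hT]⟩

/-- A one-factor product has the profile of its only factor. -/
theorem isoProfile_directProduct_unique {ι : Type*} [Unique ι] {V : ι → Type*}
    (H : ∀ i, SimpleGraph (V i)) (ν : ℝ) :
    isoProfile (directProduct H) ν = isoProfile (H default) ν := by
  refine isoProfile_congr ⟨Equiv.piUnique V, ?_⟩ ν
  intro f g
  rw [directProduct_adj, Unique.forall_iff]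
  rfl

/-! Let `φ` be the profile of a product and `ψ` the profile after multiplying by one more complete
multipartite graph, of independence ratio `β`; put `R = (1 - β) / β`. For a set in the larger
product let `x` be the measure of a largest slice, at a vertex `a`, and `y ≤ x` the largest measure
of a slice outside the class of `a`. The set has measure at most `βx + (1 - β)y`, its boundary at
least `(1 - β)φ(x) + βφ(y)`. Conversely, nested sets placed on a largest class and on its complement
bound `ψ` from above; nestedness is automatic if `x = 1` or `y = 0`. The recursion follows once such
extreme pairs are optimal, which is what `Exchange φ R` provides (`ProfileStep.eq_stepProfile`).

`Exchange` at ratio `r` is proved by induction on the number of factors, for every `r > 0` that is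
at most each product of the ratios `R` over a nonempty set of factors; the hypothesis of the theorem
is this condition at the last ratio. A new factor splits the two weights of `ψ` into four weights of
`φ`, with exchanges at ratios `r`, `r`, `rR` and `r / R`. If `β ≥ 1/2`, uncrossing by union and
intersection handles arbitrary pairs and all four exchanges are used. If `β ≤ 1/2`, the ordering of
the factors gives `Exchange φ R`, so `ψ` obeys the recursion, only extreme pairs occur, and ratio
`rR` is not needed. The induction starts from a looped point, the neutral element of the direct
product. -/

/-! ### Profiles, the exchange property and the recursion -/

/-- A normalised profile on `[0, 1]`: monotone, from `0` to `1`. -/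
structure IsNormalizedProfile (φ : ℝ → ℝ) : Prop where
  mono : ∀ ⦃x y : ℝ⦄, x ≤ y → y ≤ 1 → φ x ≤ φ y
  zero : φ 0 = 0
  one : φ 1 = 1

/-- The exchange property with ratio `r`: from a pair of weights `x ≥ y`, where `y` carries mass
`r` and cost `1 / r` relative to `x`, mass can be shifted from `y` to `x` until `x` is full or `y`
is empty, without losing mass or increasing the cost. -/
def Exchange (φ : ℝ → ℝ) (r : ℝ) : Prop :=
  ∀ x y : ℝ, 0 ≤ y → y ≤ x → x ≤ 1 → ∃ x' y' : ℝ, x' ∈ Set.Icc (0 : ℝ) 1 ∧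
    y' ∈ Set.Icc (0 : ℝ) 1 ∧ (x' = 1 ∨ y' = 0) ∧ x + r * y ≤ x' + r * y' ∧
    φ x' + φ y' / r ≤ φ x + φ y / r

/-- The relation between the profile `φ` of a graph and the profile `ψ` of its product with a
complete multipartite graph of independence ratio `β`. -/
structure ProfileStep (φ ψ : ℝ → ℝ) (β : ℝ) : Prop where
  exists_split : ∀ ν ≤ (1 : ℝ), ∃ x y : ℝ, 0 ≤ y ∧ y ≤ x ∧ x ≤ 1 ∧
    ν ≤ β * x + (1 - β) * y ∧ (1 - β) * φ x + β * φ y ≤ ψ ν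
  le_of_empty : ∀ x ∈ Set.Icc (0 : ℝ) 1, ψ (β * x) ≤ (1 - β) * φ x
  le_of_full : ∀ y ∈ Set.Icc (0 : ℝ) 1, ψ (β + (1 - β) * y) ≤ 1 - β + β * φ y
  le_of_half_le : 1 / 2 ≤ β → ∀ x ∈ Set.Icc (0 : ℝ) 1, ∀ y ∈ Set.Icc (0 : ℝ) 1,
    ψ (β * x + (1 - β) * y) ≤ (1 - β) * φ x + β * φ y

/-- The recursion of the isoperimetric profile. -/
noncomputable def stepProfile (φ : ℝ → ℝ) (β ν : ℝ) : ℝ :=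
  if ν = 0 then 0 else if ν ≤ β then (1 - β) * φ (ν / β)
  else 1 - β + β * φ ((ν - β) / (1 - β))

/-- For ratios at most `1` the order of the two weights is irrelevant. -/
theorem Exchange.of_le_one {φ : ℝ → ℝ} {r : ℝ} (hφ : IsNormalizedProfile φ) (h : Exchange φ r)
    (hr : 0 < r) (hr1 : r ≤ 1) {x y : ℝ} (hx : x ∈ Set.Icc (0 : ℝ) 1)
    (hy : y ∈ Set.Icc (0 : ℝ) 1) :
    ∃ x' y' : ℝ, x' ∈ Set.Icc (0 : ℝ) 1 ∧ y' ∈ Set.Icc (0 : ℝ) 1 ∧ (x' = 1 ∨ y' = 0) ∧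
      x + r * y ≤ x' + r * y' ∧ φ x' + φ y' / r ≤ φ x + φ y / r := by
  rcases le_total y x with hyx | hxy
  · exact h x y hy.1 hyx hx.2
  -- Since `r ≤ 1`, swapping so that the larger weight comes first gains mass and lowers the cost.
  · obtain ⟨x', y', hx', hy', ht, hm, hc⟩ := h y x hx.1 hxy hy.2
    refine ⟨x', y', hx', hy', ht, by nlinarith, hc.trans ?_⟩
    have h1 := hφ.mono hxy hy.2
    have h2 : (φ y - φ x) * 1 ≤ (φ y - φ x) * r⁻¹ :=
      mul_le_mul_of_nonneg_left ((one_le_inv₀ hr).2 hr1) (by linarith)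
    rw [div_eq_mul_inv, div_eq_mul_inv]
    linarith

/-- Exchange with arbitrary weights `a, b` for the mass and `c, d` for the cost. -/
theorem exchange_weighted {φ : ℝ → ℝ} {a b c d x y : ℝ} (ha : 0 < a) (hb : 0 < b) (hc : 0 < c)
    (h : a * c = b * d)
    (hex : ∃ x' y' : ℝ, x' ∈ Set.Icc (0 : ℝ) 1 ∧ y' ∈ Set.Icc (0 : ℝ) 1 ∧ (x' = 1 ∨ y' = 0) ∧
      x + b / a * y ≤ x' + b / a * y' ∧ φ x' + φ y' / (b / a) ≤ φ x + φ y / (b / a)) :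
    ∃ x' y' : ℝ, x' ∈ Set.Icc (0 : ℝ) 1 ∧ y' ∈ Set.Icc (0 : ℝ) 1 ∧ (x' = 1 ∨ y' = 0) ∧
      a * x + b * y ≤ a * x' + b * y' ∧ c * φ x' + d * φ y' ≤ c * φ x + d * φ y := by
  obtain ⟨x', y', hx', hy', ht, hm, hcost⟩ := hex
  have hd : d = c * (a / b) := by field_simp; linarith
  refine ⟨x', y', hx', hy', ht, ?_, ?_⟩
  · have := mul_le_mul_of_nonneg_left hm ha.le
    have e : ∀ s t : ℝ, a * (s + b / a * t) = a * s + b * t := fun s t => by field_simp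
    rwa [e, e] at this
  · have := mul_le_mul_of_nonneg_left hcost hc.le
    have e : ∀ s t : ℝ, c * (s + t / (b / a)) = c * s + d * t := fun s t => by
      rw [hd]; field_simp
    rwa [e, e] at this

/-- A profile with the exchange property satisfies the recursion. -/
theorem ProfileStep.eq_stepProfile {φ ψ : ℝ → ℝ} {β : ℝ} (hφ : IsNormalizedProfile φ)
    (hψ : IsNormalizedProfile ψ) (hs : ProfileStep φ ψ β) (h0 : 0 < β) (h1 : β < 1)
    (hex : Exchange φ ((1 - β) / β)) {ν : ℝ} (hν : ν ∈ Set.Icc (0 : ℝ) 1) :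
    ψ ν = stepProfile φ β ν := by
  have h1' : 0 < 1 - β := by linarith
  unfold stepProfile
  split_ifs with hz hle
  · rw [hz, hψ.zero]
  · apply le_antisymm
    · have := hs.le_of_empty (ν / β) ⟨div_nonneg hν.1 h0.le, (div_le_one h0).2 hle⟩
      rwa [mul_div_cancel₀ _ h0.ne'] at this
    · obtain ⟨x, y, hy, hyx, hx, hm, hc⟩ := hs.exists_split ν hν.2
      obtain ⟨x', y', hx', hy', ht, hm', hc'⟩ := exchange_weighted (c := 1 - β) (d := β) h0 h1' h1'
        (by ring) (hex x y hy hyx hx)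
      refine le_trans ?_ (hc'.trans hc)
      have hy0 : 0 ≤ φ y' := hφ.zero ▸ hφ.mono hy'.1 hy'.2
      rcases ht with rfl | rfl
      · have : φ (ν / β) ≤ φ 1 := hφ.mono ((div_le_one h0).2 hle) le_rfl
        nlinarith
      · have : φ (ν / β) ≤ φ x' := hφ.mono ((div_le_iff₀ h0).2 (by linarith)) hx'.2
        nlinarith
  · rw [not_le] at hle
    apply le_antisymm
    · have := hs.le_of_full ((ν - β) / (1 - β))
        ⟨div_nonneg (by linarith) h1'.le, (div_le_one h1').2 (by linarith [hν.2])⟩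
      rwa [mul_div_cancel₀ _ h1'.ne', add_sub_cancel] at this
    · obtain ⟨x, y, hy, hyx, hx, hm, hc⟩ := hs.exists_split ν hν.2
      obtain ⟨x', y', hx', hy', ht, hm', hc'⟩ := exchange_weighted (c := 1 - β) (d := β) h0 h1' h1'
        (by ring) (hex x y hy hyx hx)
      refine le_trans ?_ (hc'.trans hc)
      rcases ht with rfl | rfl
      · have : φ ((ν - β) / (1 - β)) ≤ φ y' :=
          hφ.mono ((div_le_iff₀ h1').2 (by linarith)) hy'.2
        rw [hφ.one]
        nlinarith
      -- `y' = 0` is impossible: the mass would be at most `β < ν`.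
      · nlinarith [hx'.2]

/-! ### Inheritance of the exchange property -/

/-- Four weights, two for each of two points, are exhausted by exchanges, provided that every
exchange between a weight of the first point and a weight of the second one is possible. -/
theorem exists_exhausted {φ : ℝ → ℝ} {β r : ℝ} (hφ : IsNormalizedProfile φ) (h0 : 0 < β)
    (h1 : β < 1) (hr : 0 < r) (hr1 : r ≤ 1) (hex : Exchange φ r)
    (hdiv : r / ((1 - β) / β) ≤ 1) (hexdiv : Exchange φ (r / ((1 - β) / β)))
    (hmul : r * ((1 - β) / β) ≤ 1) (hexmul : Exchange φ (r * ((1 - β) / β)))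
    {x₁ x₂ y₁ y₂ : ℝ} (hx₁ : x₁ ∈ Set.Icc (0 : ℝ) 1) (hx₂ : x₂ ∈ Set.Icc (0 : ℝ) 1)
    (hy₁ : y₁ ∈ Set.Icc (0 : ℝ) 1) (hy₂ : y₂ ∈ Set.Icc (0 : ℝ) 1) :
    ∃ x₁' ∈ Set.Icc (0 : ℝ) 1, ∃ x₂' ∈ Set.Icc (0 : ℝ) 1, ∃ y₁' ∈ Set.Icc (0 : ℝ) 1,
      ∃ y₂' ∈ Set.Icc (0 : ℝ) 1, (x₁' = 1 ∧ x₂' = 1 ∨ y₁' = 0 ∧ y₂' = 0) ∧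
      β * x₁ + (1 - β) * x₂ + r * (β * y₁ + (1 - β) * y₂) ≤
        β * x₁' + (1 - β) * x₂' + r * (β * y₁' + (1 - β) * y₂') ∧
      (1 - β) * φ x₁' + β * φ x₂' + ((1 - β) * φ y₁' + β * φ y₂') / r ≤
        (1 - β) * φ x₁ + β * φ x₂ + ((1 - β) * φ y₁ + β * φ y₂) / r := by
  have h1' : 0 < 1 - β := by linarith
  -- The move `mij` shifts mass from `yⱼ` to `xᵢ`.
  have m11 : ∀ {x y : ℝ}, x ∈ Set.Icc (0 : ℝ) 1 → y ∈ Set.Icc (0 : ℝ) 1 → _ := fun {x y} hx hy =>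
    exchange_weighted (φ := φ) (a := β) (b := r * β) (c := 1 - β) (d := (1 - β) / r) (x := x)
      (y := y) h0 (by positivity) h1' (by field_simp) (by
        rw [show r * β / β = r by field_simp]; exact hex.of_le_one hφ hr hr1 hx hy)
  have m22 : ∀ {x y : ℝ}, x ∈ Set.Icc (0 : ℝ) 1 → y ∈ Set.Icc (0 : ℝ) 1 → _ := fun {x y} hx hy =>
    exchange_weighted (φ := φ) (a := 1 - β) (b := r * (1 - β)) (c := β) (d := β / r) (x := x)
      (y := y) h1' (by positivity) h0 (by field_simp) (by
        rw [show r * (1 - β) / (1 - β) = r by field_simp]; exact hex.of_le_one hφ hr hr1 hx hy)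
  have m12 : ∀ {x y : ℝ}, x ∈ Set.Icc (0 : ℝ) 1 → y ∈ Set.Icc (0 : ℝ) 1 → _ := fun {x y} hx hy =>
    exchange_weighted (φ := φ) (a := β) (b := r * (1 - β)) (c := 1 - β) (d := β / r) (x := x)
      (y := y) h0 (by positivity) h1' (by field_simp) (by
        rw [mul_div_assoc]; exact hexmul.of_le_one hφ (by positivity) hmul hx hy)
  have m21 : ∀ {x y : ℝ}, x ∈ Set.Icc (0 : ℝ) 1 → y ∈ Set.Icc (0 : ℝ) 1 → _ := fun {x y} hx hy =>
    exchange_weighted (φ := φ) (a := 1 - β) (b := r * β) (c := β) (d := (1 - β) / r) (x := x)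
      (y := y) h1' (by positivity) h0 (by field_simp) (by
        rw [show r * β / (1 - β) = r / ((1 - β) / β) by field_simp]
        exact hexdiv.of_le_one hφ (by positivity) hdiv hx hy)
  have ediv : ∀ s t : ℝ, ((1 - β) * s + β * t) / r = (1 - β) / r * s + β / r * t := fun s t => by
    ring
  simp only [ediv]
  -- Each move fills its `x` or empties its `y`; the survivor is paired with the next open weight of
  -- the other point, so at most three moves are needed.
  obtain ⟨x₁', y₁', hx₁', hy₁', ht, hm, hc⟩ := m11 hx₁ hy₁
  rcases ht with rfl | rfl
  · obtain ⟨x₂', y₁'', hx₂', hy₁'', ht', hm', hc'⟩ := m21 hx₂ hy₁'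
    rcases ht' with rfl | rfl
    · exact ⟨1, hx₁', 1, hx₂', y₁'', hy₁'', y₂, hy₂, .inl ⟨rfl, rfl⟩, by linarith, by linarith⟩
    · obtain ⟨x₂'', y₂', hx₂'', hy₂', ht'', hm'', hc''⟩ := m22 hx₂' hy₂
      refine ⟨1, hx₁', x₂'', hx₂'', 0, hy₁'', y₂', hy₂', ?_, by linarith, by linarith⟩
      simpa using ht''
  · obtain ⟨x₁'', y₂', hx₁'', hy₂', ht', hm', hc'⟩ := m12 hx₁' hy₂
    rcases ht' with rfl | rfl
    · obtain ⟨x₂', y₂'', hx₂', hy₂'', ht'', hm'', hc''⟩ := m22 hx₂ hy₂'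
      refine ⟨1, hx₁'', x₂', hx₂', 0, hy₁', y₂'', hy₂'', ?_, by linarith, by linarith⟩
      simpa using ht''
    · exact ⟨x₁'', hx₁'', x₂, hx₂, 0, hy₁', 0, hy₂', .inr ⟨rfl, rfl⟩, by linarith, by linarith⟩

/-- The exchange property is inherited by the product with a factor with `β ≥ 1 / 2`. -/
theorem ProfileStep.exchange_of_half_le {φ ψ : ℝ → ℝ} {β r : ℝ} (hφ : IsNormalizedProfile φ)
    (hs : ProfileStep φ ψ β) (hβ : 1 / 2 ≤ β) (h1 : β < 1)
    (hr : 0 < r) (hrR : r ≤ (1 - β) / β) (hex : Exchange φ r)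
    (hexdiv : Exchange φ (r / ((1 - β) / β))) (hexmul : Exchange φ (r * ((1 - β) / β))) :
    Exchange ψ r := by
  intro x y hy hyx hx
  have h0 : 0 < β := by linarith
  have h1' : 0 < 1 - β := by linarith
  have hR0 : 0 < (1 - β) / β := by positivity
  have hR : (1 - β) / β ≤ 1 := (div_le_one h0).2 (by linarith)
  obtain ⟨x₁, x₂, hx₂, hx₁₂, hx₁, hxm, hxc⟩ := hs.exists_split x hx
  obtain ⟨y₁, y₂, hy₂, hy₁₂, hy₁, hym, hyc⟩ := hs.exists_split y (hyx.trans hx)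
  obtain ⟨x₁', hx₁', x₂', hx₂', y₁', hy₁', y₂', hy₂', ht, hm, hc⟩ :=
    exists_exhausted hφ h0 h1 hr (hrR.trans hR) hex ((div_le_one hR0).2 hrR) hexdiv
      (mul_le_one₀ (hrR.trans hR) hR0.le hR) hexmul (x₁ := x₁) (x₂ := x₂) (y₁ := y₁) (y₂ := y₂)
      ⟨by linarith, by linarith⟩ ⟨by linarith, by linarith⟩ ⟨by linarith, by linarith⟩
      ⟨by linarith, by linarith⟩
  have hmem : ∀ {s t : ℝ}, s ∈ Set.Icc (0 : ℝ) 1 → t ∈ Set.Icc (0 : ℝ) 1 →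
      β * s + (1 - β) * t ∈ Set.Icc (0 : ℝ) 1 := fun {s t} hs ht =>
    ⟨by have := hs.1; have := ht.1; positivity, by nlinarith [hs.2, ht.2]⟩
  refine ⟨β * x₁' + (1 - β) * x₂', β * y₁' + (1 - β) * y₂', hmem hx₁' hx₂', hmem hy₁' hy₂', ?_,
    ?_, ?_⟩
  · rcases ht with ⟨rfl, rfl⟩ | ⟨rfl, rfl⟩
    · left; ring
    · right; ring
  · have := mul_le_mul_of_nonneg_left hym hr.le
    linarith
  -- The new pairs need be neither extreme nor ordered (`y₁' = 0 < y₂'` can occur), hence the need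
  -- for `β ≥ 1/2`.
  · have hX := hs.le_of_half_le hβ x₁' hx₁' x₂' hx₂'
    have hY := div_le_div_of_nonneg_right (hs.le_of_half_le hβ y₁' hy₁' y₂' hy₂') hr.le
    have hyc' := div_le_div_of_nonneg_right hyc hr.le
    linarith

/-- The exchange property is inherited by the product with a factor with `β ≤ 1 / 2`. -/
theorem ProfileStep.exchange_of_le_half {φ ψ : ℝ → ℝ} {β r : ℝ} (hφ : IsNormalizedProfile φ)
    (hψ : IsNormalizedProfile ψ) (hs : ProfileStep φ ψ β) (h0 : 0 < β) (h1 : β < 1)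
    (hr : 0 < r) (hrR : r ≤ (1 - β) / β) (hex : Exchange φ r)
    (hexdiv : Exchange φ (r / ((1 - β) / β))) (hexR : Exchange φ ((1 - β) / β)) :
    Exchange ψ r := by
  intro x y hy hyx hx
  have h1' : 0 < 1 - β := by linarith
  have hR0 : 0 < (1 - β) / β := by positivity
  -- Here `r` may exceed `1`, so the moves at ratio `r` require ordered weights. The move at ratio
  -- `r / R ≤ 1` does not.
  have m11 : ∀ {x y : ℝ}, 0 ≤ y → y ≤ x → x ≤ 1 → _ := fun {x y} hy hyx hx =>
    exchange_weighted (φ := φ) (a := β) (b := r * β) (c := 1 - β) (d := (1 - β) / r) (x := x)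
      (y := y) h0 (by positivity) h1' (by field_simp) (by
        rw [show r * β / β = r by field_simp]; exact hex x y hy hyx hx)
  have m22 : ∀ {x y : ℝ}, 0 ≤ y → y ≤ x → x ≤ 1 → _ := fun {x y} hy hyx hx =>
    exchange_weighted (φ := φ) (a := 1 - β) (b := r * (1 - β)) (c := β) (d := β / r) (x := x)
      (y := y) h1' (by positivity) h0 (by field_simp) (by
        rw [show r * (1 - β) / (1 - β) = r by field_simp]; exact hex x y hy hyx hx)
  have m21 : ∀ {x y : ℝ}, x ∈ Set.Icc (0 : ℝ) 1 → y ∈ Set.Icc (0 : ℝ) 1 → _ := fun {x y} hx hy =>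
    exchange_weighted (φ := φ) (a := 1 - β) (b := r * β) (c := β) (d := (1 - β) / r) (x := x)
      (y := y) h1' (by positivity) h0 (by field_simp) (by
        rw [show r * β / (1 - β) = r / ((1 - β) / β) by field_simp]
        exact hexdiv.of_le_one hφ (by positivity) ((div_le_one hR0).2 hrR) hx hy)
  have i0 : (0 : ℝ) ∈ Set.Icc (0 : ℝ) 1 := by simp
  have i1 : (1 : ℝ) ∈ Set.Icc (0 : ℝ) 1 := by simp
  have hψle : ∀ s ∈ Set.Icc (0 : ℝ) 1, ∀ t ∈ Set.Icc (0 : ℝ) 1, (s = 1 ∨ t = 0) →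
      ψ (β * s + (1 - β) * t) ≤ (1 - β) * φ s + β * φ t := by
    rintro s hs' t ht' (rfl | rfl)
    · simpa [hφ.one] using hs.le_of_full t ht'
    · simpa [hφ.zero] using hs.le_of_empty s hs'
  -- Exchange at ratio `R` makes the recursion exact, so each value of `ψ` comes from an extreme
  -- pair.
  have hrep : ∀ ν ∈ Set.Icc (0 : ℝ) 1, ∃ s ∈ Set.Icc (0 : ℝ) 1, ∃ t ∈ Set.Icc (0 : ℝ) 1,
      (s = 1 ∨ t = 0) ∧ ν = β * s + (1 - β) * t ∧ ψ ν = (1 - β) * φ s + β * φ t := by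
    intro ν hν
    have he := hs.eq_stepProfile hφ hψ h0 h1 hexR hν
    unfold stepProfile at he
    split_ifs at he with hz hle
    · exact ⟨0, i0, 0, i0, .inr rfl, by rw [hz]; ring, by rw [he, hφ.zero]; ring⟩
    · exact ⟨ν / β, ⟨div_nonneg hν.1 h0.le, (div_le_one h0).2 hle⟩, 0, i0, .inr rfl,
        by field_simp; ring, by rw [he, hφ.zero]; ring⟩
    · rw [not_le] at hle
      exact ⟨1, i1, (ν - β) / (1 - β), ⟨div_nonneg (by linarith) h1'.le,
        (div_le_one h1').2 (by linarith [hν.2])⟩, .inl rfl, by field_simp; ring,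
        by rw [he, hφ.one]; ring⟩
  have key : ∀ x₁' ∈ Set.Icc (0 : ℝ) 1, ∀ x₂' ∈ Set.Icc (0 : ℝ) 1, ∀ y₁' ∈ Set.Icc (0 : ℝ) 1,
      ∀ y₂' ∈ Set.Icc (0 : ℝ) 1, (x₁' = 1 ∨ x₂' = 0) → (y₁' = 1 ∨ y₂' = 0) →
      (x₁' = 1 ∧ x₂' = 1 ∨ y₁' = 0 ∧ y₂' = 0) →
      x + r * y ≤ β * x₁' + (1 - β) * x₂' + (r * β * y₁' + r * (1 - β) * y₂') →
      (1 - β) * φ x₁' + β * φ x₂' + ((1 - β) / r * φ y₁' + β / r * φ y₂') ≤ ψ x + ψ y / r →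
      ∃ x' y' : ℝ, x' ∈ Set.Icc (0 : ℝ) 1 ∧ y' ∈ Set.Icc (0 : ℝ) 1 ∧ (x' = 1 ∨ y' = 0) ∧
        x + r * y ≤ x' + r * y' ∧ ψ x' + ψ y' / r ≤ ψ x + ψ y / r := by
    intro x₁' hx₁' x₂' hx₂' y₁' hy₁' y₂' hy₂' hX hY ht hm hc
    have hmem : ∀ {s t : ℝ}, s ∈ Set.Icc (0 : ℝ) 1 → t ∈ Set.Icc (0 : ℝ) 1 →
        β * s + (1 - β) * t ∈ Set.Icc (0 : ℝ) 1 := fun {s t} hs ht =>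
      ⟨by have := hs.1; have := ht.1; positivity, by nlinarith [hs.2, ht.2]⟩
    refine ⟨β * x₁' + (1 - β) * x₂', β * y₁' + (1 - β) * y₂', hmem hx₁' hx₂', hmem hy₁' hy₂', ?_,
      by linarith, ?_⟩
    · rcases ht with ⟨rfl, rfl⟩ | ⟨rfl, rfl⟩
      · left; ring
      · right; ring
    · have hX' := hψle x₁' hx₁' x₂' hx₂' hX
      have hY' := div_le_div_of_nonneg_right (hψle y₁' hy₁' y₂' hy₂' hY) hr.le
      have : ((1 - β) * φ y₁' + β * φ y₂') / r = (1 - β) / r * φ y₁' + β / r * φ y₂' := by ring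
      linarith
  obtain ⟨x₁, hx₁, x₂, hx₂, htx, hxm, hxc⟩ := hrep x ⟨hy.trans hyx, hx⟩
  obtain ⟨y₁, hy₁, y₂, hy₂, hty, hym, hyc⟩ := hrep y ⟨hy, hyx.trans hx⟩
  have hmass : x + r * y = β * x₁ + (1 - β) * x₂ + (r * β * y₁ + r * (1 - β) * y₂) := by
    rw [hxm, hym]; ring
  have hcost : ψ x + ψ y / r =
      (1 - β) * φ x₁ + β * φ x₂ + ((1 - β) / r * φ y₁ + β / r * φ y₂) := by
    rw [hxc, hyc]; ring
  have hz := hφ.zero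
  have ho := hφ.one
  rcases htx with rfl | rfl
  · rcases hty with rfl | rfl
    · have h12 : y₂ ≤ x₂ := by
        refine le_of_mul_le_mul_left ?_ h1'
        linarith
      obtain ⟨x₂', y₂', hx₂', hy₂', ht, hm, hc⟩ := m22 hy₂.1 h12 hx₂.2
      rcases ht with rfl | rfl
      · exact key 1 i1 1 i1 1 i1 y₂' hy₂' (.inl rfl) (.inl rfl) (.inl ⟨rfl, rfl⟩) (by linarith)
          (by linarith)
      · obtain ⟨x₂'', y₁', hx₂'', hy₁', ht', hm', hc'⟩ := m21 hx₂' i1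
        refine key 1 i1 x₂'' hx₂'' y₁' hy₁' 0 i0 (.inl rfl) (.inr rfl) (by simpa using ht')
          (by linarith) (by linarith)
    · obtain ⟨x₂', y₁', hx₂', hy₁', ht, hm, hc⟩ := m21 hx₂ hy₁
      exact key 1 i1 x₂' hx₂' y₁' hy₁' 0 i0 (.inl rfl) (.inr rfl) (by simpa using ht)
        (by linarith) (by linarith)
  · rcases hty with rfl | rfl
    -- Here `x ≤ β ≤ y`, so `y ≤ x` forces `x = y = β`.
    · have e1 : x₁ = 1 := by
        refine le_antisymm hx₁.2 (le_of_mul_le_mul_left ?_ h0)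
        have := mul_nonneg h1'.le hy₂.1
        linarith
      have e2 : y₂ = 0 := by
        refine le_antisymm (le_of_mul_le_mul_left ?_ h1') hy₂.1
        rw [e1] at hxm
        linarith
      subst e1 e2
      obtain ⟨x₂', y₁', hx₂', hy₁', ht, hm, hc⟩ := m21 i0 i1
      exact key 1 i1 x₂' hx₂' y₁' hy₁' 0 i0 (.inl rfl) (.inr rfl) (by simpa using ht)
        (by linarith) (by linarith)
    · have h12 : y₁ ≤ x₁ := by
        refine le_of_mul_le_mul_left ?_ h0
        linarith
      obtain ⟨x₁', y₁', hx₁', hy₁', ht, hm, hc⟩ := m11 hy₁.1 h12 hx₁.2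
      rcases ht with rfl | rfl
      · obtain ⟨x₂', y₁'', hx₂', hy₁'', ht', hm', hc'⟩ := m21 i0 hy₁'
        exact key 1 i1 x₂' hx₂' y₁'' hy₁'' 0 i0 (.inl rfl) (.inr rfl) (by simpa using ht')
          (by linarith) (by linarith)
      · exact key x₁' hx₁' 0 i0 0 i0 0 i0 (.inr rfl) (.inr rfl) (.inr ⟨rfl, rfl⟩)
          (by linarith) (by linarith)

/-! ### Profiles of relations with loops allowed -/

/-- The boundary of a set with respect to a relation, which may have loops. -/
def relBoundary {V : Type*} (R : V → V → Prop) (S : Set V) : Set V :=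
  {w | ∃ v ∈ S, R v w}

/-- The isoperimetric profile of a relation, which may have loops. -/
noncomputable def relProfile {V : Type*} (R : V → V → Prop) (ν : ℝ) : ℝ :=
  sInf {x : ℝ | ∃ S : Set V, ν ≤ uniformMeasure S ∧ x = uniformMeasure (relBoundary R S)}

/-- The direct product of two relations. -/
def prodRel {W U : Type*} (Q : W → W → Prop) (R : U → U → Prop) (p q : W × U) : Prop :=
  Q p.1 q.1 ∧ R p.2 q.2

theorem isoProfile_eq_relProfile {V : Type*} (G : SimpleGraph V) :
    isoProfile G = relProfile G.Adj := rfl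

theorem relProfile_congr {V W : Type*} {R : V → V → Prop} {Q : W → W → Prop} (e : V ≃ W)
    (he : ∀ v w, Q (e v) (e w) ↔ R v w) : relProfile R = relProfile Q := by
  have hμ : ∀ S : Set V, uniformMeasure (e '' S) = uniformMeasure S := fun S => by
    rw [uniformMeasure, uniformMeasure, Set.ncard_image_of_injective _ e.injective,
      Nat.card_congr e]
  have hb : ∀ S : Set V, relBoundary Q (e '' S) = e '' relBoundary R S := fun S => by
    ext w
    obtain ⟨w, rfl⟩ := e.surjective w
    simp [relBoundary, he, -Set.mem_image_equiv]
  ext ν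
  unfold relProfile
  congr 1
  ext x
  constructor
  · rintro ⟨S, h, rfl⟩
    exact ⟨e '' S, by rwa [hμ], by rw [hb, hμ]⟩
  · rintro ⟨T, h, rfl⟩
    have hT : e '' (e ⁻¹' T) = T := Set.image_preimage_eq T e.surjective
    rw [← hT, hμ] at h
    exact ⟨e ⁻¹' T, h, by rw [← hμ, ← hb, hT]⟩

theorem uniformMeasure_nonneg {V : Type*} (S : Set V) : 0 ≤ uniformMeasure S := by
  unfold uniformMeasure; positivity

theorem uniformMeasure_mono {V : Type*} [Finite V] {S T : Set V} (h : S ⊆ T) : uniformMeasure S ≤ uniformMeasure T := by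
  unfold uniformMeasure
  gcongr
  exact T.toFinite

theorem uniformMeasure_univ {V : Type*} [Finite V] [Nonempty V] : uniformMeasure (Set.univ : Set V) = 1 := by
  have : (Nat.card V : ℝ) ≠ 0 := by exact_mod_cast Nat.card_pos.ne'
  simp [uniformMeasure, Set.ncard_univ, this]

theorem uniformMeasure_le_one {V : Type*} [Finite V] [Nonempty V] (S : Set V) : uniformMeasure S ≤ 1 :=
  uniformMeasure_univ (V := V) ▸ uniformMeasure_mono S.subset_univ

theorem uniformMeasure_empty {V : Type*} : uniformMeasure (∅ : Set V) = 0 := by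
  simp [uniformMeasure]

theorem eq_univ_of_one_le_uniformMeasure {V : Type*} [Finite V] [Nonempty V] {S : Set V}
    (h : 1 ≤ uniformMeasure S) :
    S = Set.univ := by
  have h0 : (0 : ℝ) < Nat.card V := by exact_mod_cast Nat.card_pos
  rw [uniformMeasure, le_div_iff₀ h0, one_mul] at h
  refine Set.eq_of_subset_of_ncard_le S.subset_univ ?_
  rw [Set.ncard_univ]
  exact_mod_cast h

theorem uniformMeasure_union_add_inter {V : Type*} [Finite V] (S T : Set V) :
    uniformMeasure (S ∪ T) + uniformMeasure (S ∩ T) = uniformMeasure S + uniformMeasure T := by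
  unfold uniformMeasure
  rw [← add_div, ← add_div]
  congr 1
  exact_mod_cast Set.ncard_union_add_ncard_inter S T

/-- The measure of a subset of a product is the average of the measures of its slices. -/
theorem uniformMeasure_prod {W U : Type*} [Fintype W] [Finite U] (S : Set (W × U)) :
    uniformMeasure S = (∑ w, uniformMeasure {u | (w, u) ∈ S}) / Nat.card W := by
  have e : S ≃ Σ w : W, {u | (w, u) ∈ S} :=
    { toFun := fun p => ⟨p.1.1, p.1.2, p.2⟩
      invFun := fun p => ⟨(p.1, p.2.1), p.2.2⟩
      left_inv := fun _ => rfl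
      right_inv := fun _ => rfl }
  have h : S.ncard = ∑ w, {u | (w, u) ∈ S}.ncard := by
    rw [← Nat.card_coe_set_eq, Nat.card_congr e, Nat.card_sigma]
    rfl
  unfold uniformMeasure
  rw [← Finset.sum_div, h, Nat.card_prod, div_div, Nat.cast_mul, mul_comm (Nat.card U : ℝ)]
  push_cast
  rfl

open Classical in
/-- The average of a function with two values. -/
theorem average_ite {W : Type*} [Fintype W] [Nonempty W] (D : Set W) (a b : ℝ) :
    (∑ w, if w ∈ D then a else b) / Nat.card W =
      uniformMeasure D * a + (1 - uniformMeasure D) * b := by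
  have h0 : (Nat.card W : ℝ) ≠ 0 := by exact_mod_cast Nat.card_pos.ne'
  have h : (∑ w, if w ∈ D then a else b) = D.ncard * a + (Nat.card W - D.ncard) * b := by
    have : ∀ w, (if w ∈ D then a else b) = (if w ∈ D then a - b else 0) + b := fun w => by
      split_ifs <;> ring
    simp_rw [this]
    rw [Finset.sum_add_distrib, ← Finset.sum_filter, Finset.sum_const, Finset.sum_const,
      Finset.card_univ, ← Nat.card_eq_fintype_card, Set.ncard_eq_toFinset_card',
      show D.toFinset = Finset.univ.filter (· ∈ D) by ext; simp]
    simp only [nsmul_eq_mul]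
    ring
  rw [h, uniformMeasure]
  field_simp

theorem isLeast_relProfile {V : Type*} [Finite V] [Nonempty V] (R : V → V → Prop) {ν : ℝ} (hν : ν ≤ 1) :
    IsLeast {x : ℝ | ∃ S : Set V, ν ≤ uniformMeasure S ∧
      x = uniformMeasure (relBoundary R S)} (relProfile R ν) := by
  have hfin : {x : ℝ | ∃ S : Set V, ν ≤ uniformMeasure S ∧
      x = uniformMeasure (relBoundary R S)}.Finite :=
    (Set.finite_range fun S : Set V => uniformMeasure (relBoundary R S)).subset
      (by rintro x ⟨S, -, rfl⟩; exact ⟨S, rfl⟩)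
  have hne : {x : ℝ | ∃ S : Set V, ν ≤ uniformMeasure S ∧
      x = uniformMeasure (relBoundary R S)}.Nonempty :=
    ⟨_, Set.univ, by rwa [uniformMeasure_univ], rfl⟩
  exact ⟨hne.csInf_mem hfin, fun x hx => csInf_le hfin.bddBelow hx⟩

theorem exists_relProfile_eq {V : Type*} [Finite V] [Nonempty V] (R : V → V → Prop) {ν : ℝ}
    (hν : ν ≤ 1) :
    ∃ S : Set V, ν ≤ uniformMeasure S ∧ relProfile R ν = uniformMeasure (relBoundary R S) :=
  (isLeast_relProfile R hν).1

theorem relProfile_le {V : Type*} [Finite V] [Nonempty V] (R : V → V → Prop) {ν : ℝ} {S : Set V}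
    (h : ν ≤ uniformMeasure S) :
    relProfile R ν ≤ uniformMeasure (relBoundary R S) :=
  (isLeast_relProfile R (h.trans (uniformMeasure_le_one S))).2 ⟨S, h, rfl⟩

theorem relBoundary_mono {V : Type*} {R : V → V → Prop} {S T : Set V} (h : S ⊆ T) :
    relBoundary R S ⊆ relBoundary R T :=
  fun _ ⟨v, hv, hw⟩ => ⟨v, h hv, hw⟩

theorem relBoundary_univ {V : Type*} {R : V → V → Prop} (hR : ∀ w, ∃ v, R v w) :
    relBoundary R Set.univ = Set.univ :=
  Set.eq_univ_of_forall fun w => (hR w).imp fun _ hv => ⟨trivial, hv⟩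

theorem relBoundary_empty {V : Type*} (R : V → V → Prop) : relBoundary R ∅ = ∅ := by
  simp [relBoundary]

theorem relProfile_zero {V : Type*} [Finite V] [Nonempty V] (R : V → V → Prop) : relProfile R 0 = 0 := by
  refine le_antisymm ?_ ?_
  · refine (relProfile_le R (S := ∅) (uniformMeasure_nonneg _)).trans ?_
    rw [relBoundary_empty, uniformMeasure_empty]
  · obtain ⟨S, -, hS⟩ := exists_relProfile_eq R zero_le_one
    exact hS ▸ uniformMeasure_nonneg _

theorem isNormalizedProfile_relProfile {V : Type*} [Finite V] [Nonempty V] {R : V → V → Prop}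
    (hR : ∀ w, ∃ v, R v w) :
    IsNormalizedProfile (relProfile R) where
  mono x y hxy hy := by
    obtain ⟨S, hS, h⟩ := exists_relProfile_eq R hy
    exact h ▸ relProfile_le R (hxy.trans hS)
  zero := relProfile_zero R
  one := by
    obtain ⟨S, hS, h⟩ := exists_relProfile_eq R le_rfl
    rw [h, eq_univ_of_one_le_uniformMeasure hS, relBoundary_univ hR, uniformMeasure_univ]

/-- The uncrossing inequality for boundaries. -/
theorem uniformMeasure_relBoundary_uncross {V : Type*} [Finite V] (R : V → V → Prop)
    (S T : Set V) :
    uniformMeasure (relBoundary R (S ∪ T)) + uniformMeasure (relBoundary R (S ∩ T)) ≤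
      uniformMeasure (relBoundary R S) + uniformMeasure (relBoundary R T) := by
  rw [← uniformMeasure_union_add_inter (relBoundary R S)]
  refine add_le_add (uniformMeasure_mono ?_) (uniformMeasure_mono ?_)
  · rintro w ⟨v, hv | hv, hw⟩
    exacts [.inl ⟨v, hv, hw⟩, .inr ⟨v, hv, hw⟩]
  · exact Set.subset_inter (relBoundary_mono Set.inter_subset_left)
      (relBoundary_mono Set.inter_subset_right)

/-! ### Multiplication by one complete multipartite graph -/

/-- Non-adjacency is transitive, so the non-neighbours of `a`, with `a` itself, form its class. -/
theorem isIndepSet_setOf_not_adj {W : Type*} {H : SimpleGraph W} (hH : H.IsCompleteMultipartite) (a : W) :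
    H.IsIndepSet {v | ¬ H.Adj a v} := fun v hv w hw _ =>
  hH.trans v a w (fun h => hv h.symm) hw

section Multipartite

variable {W : Type*} [Finite W] {H : SimpleGraph W}

theorem uniformMeasure_le_indepRatio {S : Set W} (hS : H.IsIndepSet S) :
    uniformMeasure S ≤ indepRatio H := by
  have := Fintype.ofFinite W
  classical
  unfold uniformMeasure indepRatio
  gcongr
  rw [Set.ncard_eq_toFinset_card']
  exact SimpleGraph.IsIndepSet.card_le_indepNum (by simpa using hS)

theorem exists_uniformMeasure_eq_indepRatio [Nonempty W] (hH : H.IsCompleteMultipartite) :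
    ∃ a, uniformMeasure {v | ¬ H.Adj a v} = indepRatio H := by
  have := Fintype.ofFinite W
  classical
  obtain ⟨s, hs, hc⟩ := H.exists_isNIndepSet_indepNum
  have hne : s.Nonempty := by
    rw [← Finset.card_pos, hc]
    obtain ⟨a⟩ := ‹Nonempty W›
    have : ({a} : Finset W).card ≤ H.indepNum :=
      SimpleGraph.IsIndepSet.card_le_indepNum (by simp [SimpleGraph.isIndepSet_iff])
    simpa [Nat.one_le_iff_ne_zero, Nat.pos_iff_ne_zero] using this
  obtain ⟨a, ha⟩ := hne
  refine ⟨a, le_antisymm (uniformMeasure_le_indepRatio (isIndepSet_setOf_not_adj hH a)) ?_⟩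
  have hsub : (s : Set W) ⊆ {v | ¬ H.Adj a v} := fun v hv hadj => hs ha hv hadj.ne hadj
  refine le_trans (le_of_eq ?_) (uniformMeasure_mono hsub)
  rw [uniformMeasure, indepRatio, Set.ncard_coe_finset, hc]

theorem indepRatio_pos [Nonempty W] (hH : H.IsCompleteMultipartite) : 0 < indepRatio H := by
  obtain ⟨a, ha⟩ := exists_uniformMeasure_eq_indepRatio hH
  rw [← ha]
  refine div_pos ?_ (by exact_mod_cast Nat.card_pos)
  exact_mod_cast (Set.ncard_pos (Set.toFinite _)).2 ⟨a, H.irrefl⟩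

theorem indepRatio_le_one [Nonempty W] (hH : H.IsCompleteMultipartite) : indepRatio H ≤ 1 := by
  obtain ⟨a, ha⟩ := exists_uniformMeasure_eq_indepRatio hH
  exact ha ▸ uniformMeasure_le_one _

theorem exists_adj_of_indepRatio_lt_one [Nonempty W] (hH : H.IsCompleteMultipartite)
    (h1 : indepRatio H < 1) (w : W) : ∃ v, H.Adj v w := by
  by_contra! h
  refine h1.not_ge ?_
  rw [← uniformMeasure_univ (V := W), show Set.univ = {v | ¬ H.Adj w v} from
    (Set.eq_univ_of_forall fun v hv => h v hv.symm).symm]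
  exact uniformMeasure_le_indepRatio (isIndepSet_setOf_not_adj hH w)

theorem not_adj_of_indepRatio_eq_one [Nonempty W] (hH : H.IsCompleteMultipartite)
    (h1 : indepRatio H = 1) (v w : W) : ¬ H.Adj v w := by
  obtain ⟨a, ha⟩ := exists_uniformMeasure_eq_indepRatio hH
  have hu := eq_univ_of_one_le_uniformMeasure (ha.trans h1).ge
  intro hvw
  exact isIndepSet_setOf_not_adj hH a (hu ▸ Set.mem_univ v) (hu ▸ Set.mem_univ w) hvw.ne hvw

variable [Nonempty W] {U : Type*} [Finite U] [Nonempty U] {R : U → U → Prop}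

/-- Nested sets `T₂ ⊆ T₁` are placed on a largest class and on its complement. -/
theorem relProfile_prod_le (hH : H.IsCompleteMultipartite) {T₁ T₂ : Set U} (h : T₂ ⊆ T₁) {ν : ℝ}
    (hν : ν ≤ indepRatio H * uniformMeasure T₁ + (1 - indepRatio H) * uniformMeasure T₂) :
    relProfile (prodRel H.Adj R) ν ≤ (1 - indepRatio H) * uniformMeasure (relBoundary R T₁) +
      indepRatio H * uniformMeasure (relBoundary R T₂) := by
  have := Fintype.ofFinite W
  classical
  obtain ⟨a, ha⟩ := exists_uniformMeasure_eq_indepRatio hH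
  set C : Set W := {v | ¬ H.Adj a v} with hC
  let S : Set (W × U) := {p | p.2 ∈ if p.1 ∈ C then T₁ else T₂}
  have hS : uniformMeasure S =
      indepRatio H * uniformMeasure T₁ + (1 - indepRatio H) * uniformMeasure T₂ := by
    rw [uniformMeasure_prod, ← ha, ← average_ite]
    congr 1
    refine Finset.sum_congr rfl fun w _ => ?_
    by_cases hw : w ∈ C <;> simp [S, hw]
  refine (relProfile_le _ (hν.trans_eq hS.symm)).trans ?_
  rw [uniformMeasure_prod, add_comm, ← ha, ← average_ite]
  gcongr with w
  -- Over the independent class `C` the boundary comes only from copies of `T₂`; elsewhere all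
  -- contributions lie in the boundary of the larger set `T₁`.
  by_cases hw : w ∈ C
  · rw [if_pos hw]
    refine uniformMeasure_mono ?_
    rintro u ⟨⟨w', u'⟩, hS', hadj, hR⟩
    have hw' : w' ∉ C := fun hw' => isIndepSet_setOf_not_adj hH a hw' hw hadj.ne hadj
    refine ⟨u', ?_, hR⟩
    simpa [S, hw'] using hS'
  · rw [if_neg hw]
    refine uniformMeasure_mono ?_
    rintro u ⟨⟨w', u'⟩, hS', hadj, hR⟩
    refine ⟨u', ?_, hR⟩
    by_cases hw' : w' ∈ C
    · simpa [S, hw'] using hS'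
    · exact h (by simpa [S, hw'] using hS')

/-- The isoperimetric problem on the product is bounded below by the two-weight problem. -/
theorem exists_split_relProfile_prod (hH : H.IsCompleteMultipartite) (h1 : indepRatio H < 1)
    (hR : ∀ w, ∃ v, R v w) {ν : ℝ} (hν : ν ≤ 1) : ∃ x y : ℝ, 0 ≤ y ∧ y ≤ x ∧ x ≤ 1 ∧
      ν ≤ indepRatio H * x + (1 - indepRatio H) * y ∧
      (1 - indepRatio H) * relProfile R x + indepRatio H * relProfile R y ≤
        relProfile (prodRel H.Adj R) ν := by
  have := Fintype.ofFinite W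
  classical
  obtain ⟨S, hS, hSb⟩ := exists_relProfile_eq (prodRel H.Adj R) hν
  rw [hSb]
  let T : W → Set U := fun w => {u | (w, u) ∈ S}
  obtain ⟨a, ha⟩ := Finite.exists_max fun w => uniformMeasure (T w)
  set D : Set W := {v | ¬ H.Adj a v} with hD
  have hDle : uniformMeasure D ≤ indepRatio H :=
    uniformMeasure_le_indepRatio (isIndepSet_setOf_not_adj hH a)
  obtain ⟨v, hv⟩ := exists_adj_of_indepRatio_lt_one hH h1 a
  obtain ⟨b, hb, hbmax⟩ := Set.exists_max_image {w | H.Adj a w} (fun w => uniformMeasure (T w))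
    (Set.toFinite _) ⟨v, hv.symm⟩
  have hmono := (isNormalizedProfile_relProfile hR).mono (ha b) (uniformMeasure_le_one _)
  have hba := ha b
  have hslice : ∀ {w w'}, H.Adj w w' →
      relProfile R (uniformMeasure (T w)) ≤ uniformMeasure {u | (w', u) ∈ relBoundary
        (prodRel H.Adj R) S} := fun {w w'} hww' =>
    (relProfile_le R le_rfl).trans (uniformMeasure_mono
      fun u ⟨u', hu', hR'⟩ => ⟨(w, u'), hu', hww', hR'⟩)
  refine ⟨uniformMeasure (T a), uniformMeasure (T b), uniformMeasure_nonneg _, hba,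
    uniformMeasure_le_one _, ?_, ?_⟩
  · have h : uniformMeasure S ≤ uniformMeasure D * uniformMeasure (T a) +
        (1 - uniformMeasure D) * uniformMeasure (T b) := by
      rw [uniformMeasure_prod, ← average_ite]
      gcongr with w
      split_ifs with hw
      · exact ha w
      · exact hbmax w (not_not.1 hw)
    -- Raising the measure of `D` to `indepRatio H` favours the larger slice.
    nlinarith
  · have h : uniformMeasure D * relProfile R (uniformMeasure (T b)) +
        (1 - uniformMeasure D) * relProfile R (uniformMeasure (T a)) ≤
        uniformMeasure (relBoundary (prodRel H.Adj R) S) := by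
      rw [uniformMeasure_prod, ← average_ite]
      gcongr with w
      split_ifs with hw
      · refine hslice ?_
        -- A vertex of `D` not adjacent to `b` would put `b` in the class of `a`.
        by_contra hbw
        exact hH.trans a w b hw (fun h => hbw h.symm) hb
      · exact hslice (not_not.1 hw)
    nlinarith

/-- Multiplication with a complete multipartite graph. -/
theorem profileStep_relProfile_prod (hH : H.IsCompleteMultipartite) (h1 : indepRatio H < 1)
    (hR : ∀ w, ∃ v, R v w) :
    ProfileStep (relProfile R) (relProfile (prodRel H.Adj R)) (indepRatio H) where
  exists_split _ hν := exists_split_relProfile_prod hH h1 hR hν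
  le_of_empty x hx := by
    obtain ⟨T, hT, h⟩ := exists_relProfile_eq R hx.2
    have hβ := indepRatio_pos hH
    refine (relProfile_prod_le hH (Set.empty_subset T) ?_).trans_eq ?_
    · rw [uniformMeasure_empty]
      nlinarith
    · rw [relBoundary_empty, uniformMeasure_empty, h]
      ring
  le_of_full y hy := by
    obtain ⟨T, hT, h⟩ := exists_relProfile_eq R hy.2
    refine (relProfile_prod_le hH (Set.subset_univ T) ?_).trans_eq ?_
    · rw [uniformMeasure_univ]
      nlinarith
    · rw [relBoundary_univ hR, uniformMeasure_univ, h]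
      ring
  le_of_half_le hβ x hx y hy := by
    obtain ⟨T₁, hT₁, h₁⟩ := exists_relProfile_eq R hx.2
    obtain ⟨T₂, hT₂, h₂⟩ := exists_relProfile_eq R hy.2
    have hm := uniformMeasure_union_add_inter T₁ T₂
    have hc := uniformMeasure_relBoundary_uncross R T₁ T₂
    have hm' : uniformMeasure T₁ ≤ uniformMeasure (T₁ ∪ T₂) :=
      uniformMeasure_mono Set.subset_union_left
    have hc' : uniformMeasure (relBoundary R (T₁ ∩ T₂)) ≤ uniformMeasure (relBoundary R T₂) :=
      uniformMeasure_mono (relBoundary_mono Set.inter_subset_right)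
    refine (relProfile_prod_le hH (T₁ := T₁ ∪ T₂) (T₂ := T₁ ∩ T₂)
      (Set.inter_subset_left.trans Set.subset_union_left) ?_).trans ?_
    -- Uncrossing moves mass to the union, whose mass coefficient `β` is the larger; the boundary
    -- cost moves off the intersection, whose cost coefficient is `β`.
    · nlinarith
    · rw [h₁, h₂]
      nlinarith

end Multipartite

/-! ### Products of several factors, starting from a looped point -/

theorem exists_prodRel {W U : Type*} {Q : W → W → Prop} {R : U → U → Prop}
    (hQ : ∀ w, ∃ v, Q v w) (hR : ∀ w, ∃ v, R v w) (p : W × U) : ∃ q, prodRel Q R q p :=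
  (hQ p.1).elim fun v hv => (hR p.2).elim fun u hu => ⟨(v, u), hv, hu⟩

/-- The profile of a looped point is the indicator of the positive numbers. -/
theorem relProfile_of_forall {U : Type*} [Subsingleton U] [Nonempty U] {R : U → U → Prop}
    (hR : ∀ u v, R u v) {ν : ℝ} (h0 : 0 < ν) (h1 : ν ≤ 1) : relProfile R ν = 1 := by
  have : Finite U := Finite.of_subsingleton
  obtain ⟨S, hS, h⟩ := exists_relProfile_eq R h1
  have hne : S.Nonempty := by
    rw [Set.nonempty_iff_ne_empty]
    rintro rfl
    rw [uniformMeasure_empty] at hS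
    linarith
  rw [h, Set.Nonempty.eq_univ hne, relBoundary_univ fun w => ⟨w, hR w w⟩, uniformMeasure_univ]

/-- Once a weight is positive it already costs `1`, so it can be filled for free. -/
theorem exchange_relProfile_of_forall {U : Type*} [Subsingleton U] [Nonempty U]
    {R : U → U → Prop} (hR : ∀ u v, R u v) (r : ℝ) : Exchange (relProfile R) r := by
  intro x y hy hyx hx
  have : Finite U := Finite.of_subsingleton
  rcases hy.eq_or_lt with rfl | hy0
  · exact ⟨x, 0, ⟨hyx, hx⟩, by simp, .inr rfl, le_rfl, le_rfl⟩
  · refine ⟨1, y, by simp, ⟨hy, hyx.trans hx⟩, .inl rfl, by linarith, ?_⟩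
    rw [relProfile_of_forall hR (hy0.trans_le hyx) hx, relProfile_of_forall hR one_pos le_rfl]

/-- The direct product of a finite family of graphs as a relation; the empty product is a looped
point. -/
def piRel {ι : Type*} {V : ι → Type*} (H : ∀ i, SimpleGraph (V i)) (f g : ∀ i, V i) : Prop :=
  ∀ i, (H i).Adj (f i) (g i)

theorem isoProfile_directProduct {ι : Type*} [Nonempty ι] {V : ι → Type*}
    (H : ∀ i, SimpleGraph (V i)) : isoProfile (directProduct H) = relProfile (piRel H) :=
  relProfile_congr (Equiv.refl _) fun f g => (directProduct_adj H f g).symm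

theorem relProfile_piRel_succ {m : ℕ} {V : Fin (m + 1) → Type*} (H : ∀ i, SimpleGraph (V i)) :
    relProfile (piRel H) =
      relProfile (prodRel (H (Fin.last m)).Adj (piRel fun k : Fin m => H k.castSucc)) := by
  refine (relProfile_congr (Fin.snocEquiv V) fun p q => ?_).symm
  simp only [piRel, prodRel, Fin.forall_fin_succ', Fin.snocEquiv_apply, Fin.snoc_castSucc,
    Fin.snoc_last]
  exact and_comm

theorem exists_piRel {ι : Type*} {V : ι → Type*} {H : ∀ i, SimpleGraph (V i)}
    (hH : ∀ i w, ∃ v, (H i).Adj v w) (f : ∀ i, V i) : ∃ g, piRel H g f := by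
  choose g hg using fun i => hH i (f i)
  exact ⟨g, hg⟩

/-- The exchange property of a direct product of complete multipartite graphs. -/
theorem exchange_relProfile_piRel (m : ℕ) : ∀ (V : Fin m → Type*) [∀ i, Finite (V i)]
    [∀ i, Nonempty (V i)] (H : ∀ i, SimpleGraph (V i)), (∀ i, (H i).IsCompleteMultipartite) →
    Monotone (fun i => indepRatio (H i)) → (∀ i, indepRatio (H i) < 1) → ∀ r : ℝ, 0 < r →
    (∀ A : Finset (Fin m), A.Nonempty →
      r ≤ ∏ k ∈ A, (1 - indepRatio (H k)) / indepRatio (H k)) →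
    Exchange (relProfile (piRel H)) r := by
  induction m with
  | zero =>
    intro V _ _ H _ _ _ r _ _
    exact exchange_relProfile_of_forall (fun u v i => i.elim0) r
  | succ m ih =>
    intro V _ _ H hH hmono h1 r hr hA
    have hpos : ∀ i, 0 < indepRatio (H i) := fun i => indepRatio_pos (hH i)
    have hrpos : ∀ i, 0 < (1 - indepRatio (H i)) / indepRatio (H i) := fun i =>
      div_pos (by linarith [h1 i]) (hpos i)
    have hmono' : Monotone fun k : Fin m => indepRatio (H k.castSucc) :=
      hmono.comp Fin.strictMono_castSucc.monotone
    have ih' := ih (fun k => V k.castSucc) (fun k => H k.castSucc) (fun k => hH _) hmono'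
      fun k => h1 _
    have hser : ∀ f, ∃ g, piRel (fun k : Fin m => H k.castSucc) g f := exists_piRel fun i w =>
      exists_adj_of_indepRatio_lt_one (hH _) (h1 _) w
    have hφ := isNormalizedProfile_relProfile hser
    have hψ := isNormalizedProfile_relProfile (exists_prodRel
      (exists_adj_of_indepRatio_lt_one (hH (Fin.last m)) (h1 _)) hser)
    have hstep := profileStep_relProfile_prod (hH (Fin.last m)) (h1 _) hser
    rw [relProfile_piRel_succ]
    set β := indepRatio (H (Fin.last m)) with hβ
    have hβ0 : 0 < β := hpos _
    have hβ1 : β < 1 := h1 _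
    have hrR : r ≤ (1 - β) / β := by simpa using hA {Fin.last m} (by simp)
    have hexr := ih' r hr fun A hne => by simpa using hA (A.map Fin.castSuccEmb) (by simpa)
    -- Adding the last factor to `A` supplies the extra `R` in `r ≤ R * ∏`.
    have hexdiv := ih' (r / ((1 - β) / β)) (div_pos hr (hrpos _)) fun A hne => by
      rw [div_le_iff₀' (hrpos _)]
      have := hA (insert (Fin.last m) (A.map Fin.castSuccEmb)) (by simp)
      rwa [Finset.prod_insert (by simp [Fin.castSucc_ne_last]), Finset.prod_map] at this
    rcases le_total β (1 / 2) with hhalf | hhalf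
    · have hR1 : 1 ≤ (1 - β) / β := (one_le_div hβ0).2 (by linarith)
      -- `R` is admissible for the earlier factors: all their ratios are at least `R ≥ 1`.
      refine hstep.exchange_of_le_half hφ hψ hβ0 hβ1 hr hrR hexr hexdiv (ih' _ (hrpos _) ?_)
      rintro A ⟨a, ha⟩
      have hge : ∀ k : Fin m, (1 - β) / β ≤
          (1 - indepRatio (H k.castSucc)) / indepRatio (H k.castSucc) := fun k => by
        have hk : indepRatio (H k.castSucc) ≤ β := hmono (Fin.le_last _)
        exact div_le_div₀ (by linarith [h1 k.castSucc]) (by linarith) (hpos _) hk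
      rw [← Finset.mul_prod_erase _ _ ha]
      have h2 : 1 ≤ ∏ k ∈ A.erase a,
          (1 - indepRatio (H k.castSucc)) / indepRatio (H k.castSucc) :=
        Finset.one_le_prod fun k _ => hR1.trans (hge k)
      nlinarith [hge a, hrpos a.castSucc]
    · have hR1 : (1 - β) / β ≤ 1 := (div_le_one hβ0).2 (by linarith)
      refine hstep.exchange_of_half_le hφ hhalf hβ1 hr hrR hexr hexdiv
        (ih' _ (mul_pos hr (hrpos _)) fun A hne => ?_)
      refine (mul_le_of_le_one_right hr.le hR1).trans ?_
      simpa using hA (A.map Fin.castSuccEmb) (by simpa)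

/-! ### Edgeless graphs, a single factor and the theorem -/

/-- The profile of an edgeless graph vanishes. -/
theorem isoProfile_of_not_adj {V : Type*} [Finite V] [Nonempty V] {G : SimpleGraph V}
    (hG : ∀ v w, ¬ G.Adj v w) {ν : ℝ} (hν : ν ≤ 1) : isoProfile G ν = 0 := by
  rw [isoProfile_eq_relProfile]
  obtain ⟨S, -, h⟩ := exists_relProfile_eq G.Adj hν
  rw [h, show relBoundary G.Adj S = ∅ by simp [relBoundary, hG], uniformMeasure_empty]

/-- The profile of a complete multipartite graph. -/
theorem isoProfile_of_isCompleteMultipartite {V : Type*} [Finite V] [Nonempty V]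
    {G : SimpleGraph V} (hG : G.IsCompleteMultipartite) {ν : ℝ} (hν : ν ∈ Set.Icc (0 : ℝ) 1) :
    isoProfile G ν = if ν = 0 then 0 else if ν ≤ indepRatio G then 1 - indepRatio G else 1 := by
  have h0 := indepRatio_pos hG
  rcases (indepRatio_le_one hG).eq_or_lt with h1 | h1
  · rw [isoProfile_of_not_adj (not_adj_of_indepRatio_eq_one hG h1) hν.2, h1]
    simp [hν.2]
  have h1' : 0 < 1 - indepRatio G := by linarith
  -- A graph is its own product with a looped point, so one step of the recursion suffices.
  let R : Unit → Unit → Prop := fun _ _ => True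
  have hR : ∀ u v, R u v := fun _ _ => trivial
  have hser : ∀ w, ∃ v, R v w := fun w => ⟨w, trivial⟩
  have he : isoProfile G = relProfile (prodRel G.Adj R) :=
    (relProfile_congr (Equiv.prodPUnit V) fun p q => (and_iff_left trivial).symm).symm
  rw [he, (profileStep_relProfile_prod hG h1 hser).eq_stepProfile
    (isNormalizedProfile_relProfile hser) (isNormalizedProfile_relProfile
      (exists_prodRel (exists_adj_of_indepRatio_lt_one hG h1) hser)) h0 h1
    (exchange_relProfile_of_forall hR _) hν, stepProfile]
  split_ifs with hz hle
  · rfl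
  · rw [relProfile_of_forall hR (div_pos (hν.1.lt_of_ne' hz) h0) ((div_le_one h0).2 hle), mul_one]
  · rw [not_le] at hle
    rw [relProfile_of_forall hR (div_pos (by linarith) h1')
      ((div_le_one h1').2 (by linarith [hν.2]))]
    ring

/-- The factors `H_1, …, H_n` are indexed by `Fin (m + 1)`, so `n = m + 1`; the last factor `H_n`
is `H (Fin.last m)` and the first `n - 1` factors are `H k.castSucc` for `k : Fin m`. -/
theorem theorem1p5 (m : ℕ) (V : Fin (m + 1) → Type*) [∀ i, Finite (V i)] [∀ i, Nonempty (V i)]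
    (H : ∀ i, SimpleGraph (V i)) (hH : ∀ i, (H i).IsCompleteMultipartite)
    (hmono : Monotone fun i => indepRatio (H i))
    (hprod : ∀ A : Finset (Fin m), A.Nonempty →
      (1 - indepRatio (H (Fin.last m))) / indepRatio (H (Fin.last m)) ≤
        ∏ k ∈ A, (1 - indepRatio (H k.castSucc)) / indepRatio (H k.castSucc)) :
    (∀ ν ∈ Set.Icc (0 : ℝ) 1,
      isoProfile (H 0) ν =
        if ν = 0 then 0
        else if ν ≤ indepRatio (H 0) then 1 - indepRatio (H 0)
        else 1) ∧
    (1 ≤ m → ∀ ν ∈ Set.Icc (0 : ℝ) 1,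
      isoProfile (directProduct H) ν =
        if ν = 0 then 0
        else if ν ≤ indepRatio (H (Fin.last m)) then
          (1 - indepRatio (H (Fin.last m))) *
            isoProfile (directProduct fun k : Fin m => H k.castSucc)
              (ν / indepRatio (H (Fin.last m)))
        else
          1 - indepRatio (H (Fin.last m)) + indepRatio (H (Fin.last m)) *
            isoProfile (directProduct fun k : Fin m => H k.castSucc)
              ((ν - indepRatio (H (Fin.last m))) / (1 - indepRatio (H (Fin.last m))))) := by
  refine ⟨fun ν hν => isoProfile_of_isCompleteMultipartite (hH 0) hν, fun hm ν hν => ?_⟩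
  have : Nonempty (Fin m) := ⟨⟨0, hm⟩⟩
  have h0 := indepRatio_pos (hH (Fin.last m))
  rcases (indepRatio_le_one (hH (Fin.last m))).eq_or_lt with h1 | h1
  -- If the last ratio is `1`, that factor and hence the product are edgeless; the case dividing by
  -- `1 - β = 0` never arises for `ν ≤ 1`.
  · rw [isoProfile_of_not_adj (G := directProduct H) (fun v w h =>
      not_adj_of_indepRatio_eq_one (hH (Fin.last m)) h1 _ _ (h.2 _)) hν.2, h1]
    simp [hν.2]
  have hlt : ∀ i, indepRatio (H i) < 1 := fun i => (hmono (Fin.le_last i)).trans_lt h1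
  have hser : ∀ f, ∃ g, piRel (fun k : Fin m => H k.castSucc) g f := exists_piRel fun i w =>
    exists_adj_of_indepRatio_lt_one (hH _) (hlt _) w
  rw [isoProfile_directProduct, isoProfile_directProduct, relProfile_piRel_succ]
  exact (profileStep_relProfile_prod (hH (Fin.last m)) h1 hser).eq_stepProfile
    (isNormalizedProfile_relProfile hser) (isNormalizedProfile_relProfile
      (exists_prodRel (exists_adj_of_indepRatio_lt_one (hH (Fin.last m)) h1) hser)) h0 h1
    (exchange_relProfile_piRel m _ _ (fun k => hH _)
      (hmono.comp Fin.strictMono_castSucc.monotone) (fun k => hlt _) _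
      (div_pos (by linarith) h0) hprod) hν
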